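/- Let $\mathcal{B}$ be a locally finitely presentable category, i.e. a locally small category with all small colimits that has an essentially small class of finitely presented objects such that every object of $\mathcal{B}$ is a small filtered colimit of objects of this class; here an object $K$ of a category $\mathcal{C}$ is called finitely presented if $\mathcal{C}(K,-)$ preserves small filtered colimits. Let $B$ be an object of $\mathcal{B}$, and let $B\downarrow\mathcal{B}$ be the coslice category, whose objects are the morphisms $l:B\to C$ of $\mathcal{B}$ and whose morphisms are the commutative triangles under $B$. Let $\mathcal{G}_B$ be the full subcategory of $B\downarrow\mathcal{B}$ on those $l:B\to C$ for which there exist a morphism $k:K\to K'$ between finitely presented objects $K,K'$ of $\mathcal{B}$, a morphism $a:K\to B$ and a morphism $a':K'\to C$ such that $$\begin{array}{ccc} K & \xrightarrow{\ k\ } & K' \\ {\scriptstyle a}\downarrow & & \downarrow{\scriptstyle a'} \\ B & \xrightarrow{\ l\ } & C \end{array}$$ is a pushout square in $\mathcal{B}$. Then the coslice $B\downarrow\mathcal{B}$ is locally finitely presentable, and an object $l:B\to C$ of $B\downarrow\mathcal{B}$ is finitely presented in $B\downarrow\mathcal{B}$ if and only if it belongs to $\mathcal{G}_B$. In particular, there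 is an equivalence of categories $$(B\downarrow\mathcal{B})_\omega\simeq\mathcal{G}_B,$$ compatible up to natural isomorphism with the inclusions into $B\downarrow\mathcal{B}$, where $(B\downarrow\mathcal{B})_\omega$ denotes the full subcategory of finitely presented objects of $B\downarrow\mathcal{B}$. -/

import Mathlib

open CategoryTheory CategoryTheory.Limits

universe w v u

/-- The coslice generator at `B`: the property of objects `l : B ⟶ C` of the coslice category
`Under B` that there are finitely presented objects `K`, `K'`, a morphism `k : K ⟶ K'`, and a
morphism `a : K ⟶ B` such that `l` is the pushout of `k` along `a`, i.e. there is a pushout square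
```
K --k--> K'
|        |
a        a'
v        v
B --l--> C
```
Finite presentability is relative to `w`-small filtered colimits. -/
def cosliceGenerator {𝓑 : Type u} [Category.{v} 𝓑] (B : 𝓑) : ObjectProperty (Under B) :=
  fun l => ∃ (K K' : 𝓑) (k : K ⟶ K') (a : K ⟶ B) (a' : K' ⟶ l.right),
    IsFinitelyPresentable.{w} K ∧ IsFinitelyPresentable.{w} K' ∧ IsPushout k a a' l.hom

open Cardinal

attribute [local instance] fact_isRegular_aleph0

section

variable {𝓑 : Type u} [Category.{v} 𝓑] {B : 𝓑}

/-! A map under `B` out of the pushout of `k : K ⟶ K'` along `a` is a map out of `K'` with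
prescribed restriction to `K`, a finite condition on finitely presentable data; so pushouts of this
kind are finitely presentable. Conversely, the coproduct inclusions `B ⟶ B ⨿ X`, with `X` in a small
generator of `𝓑`, are such pushouts and form a strong generator (`exists_isStrongGenerator_under`).
Hence the coslice is locally finitely presentable, and its finitely presentable objects are the
closure of these inclusions under finite colimits. It remains to close the class under finite
coproducts and coequalizers; the latter rests on `exists_isPushout_factorization`. -/

/-- A pushout of a morphism between finitely presentable objects is finitely presentable in the
coslice category. -/
lemma isFinitelyPresentable_of_cosliceGenerator (l : Under B) (hl : cosliceGenerator.{w} B l) :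
    IsFinitelyPresentable.{w} l where
  preservesColimitOfShape J _ _ := ⟨fun {F} ↦ ⟨fun {c} hc ↦ by
    obtain ⟨K, K', k, a, a', _, _, h⟩ := hl
    have := isFiltered_of_isCardinalFiltered J ℵ₀
    let hc' := isColimitOfPreserves (Under.forget B) hc
    refine ⟨Types.FilteredColimit.isColimitOf' _ _ (fun f ↦ ?_) (fun j f₁ f₂ hf ↦ ?_)⟩
    · dsimp at f
      obtain ⟨j, p, hp⟩ := IsFinitelyPresentable.exists_hom_of_isColimit hc' (a' ≫ f.right)
      dsimp at p hp
      -- The lift `p` agrees with the structure map on `K` only in the colimit; a later stage makes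
      -- them agree. The transition maps `u` and `v` may differ, so `s` merges them.
      obtain ⟨j', u, v, huv⟩ := IsFinitelyPresentable.exists_eq_of_isColimit hc'
        (i := j) (j := j) (k ≫ p) (a ≫ (F.obj j).hom) (by
          dsimp
          rw [Category.assoc, Category.assoc, hp, h.w_assoc]
          simp)
      obtain ⟨j'', s, hs⟩ := IsFilteredOrEmpty.cocone_maps u v
      have huv' : k ≫ p ≫ (F.map (u ≫ s)).right = a ≫ (F.obj j'').hom := by
        have h₁ := congr($huv ≫ (F.map s).right)
        have h₂ : (F.map v).right ≫ (F.map s).right = (F.map (u ≫ s)).right := by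
          rw [hs, F.map_comp]; rfl
        dsimp at h₁
        simp only [Category.assoc] at h₁
        rw [h₂] at h₁
        simpa using h₁
      refine ⟨j'', Under.homMk (h.desc (p ≫ (F.map (u ≫ s)).right) (F.obj j'').hom huv')
        (by simp), ?_⟩
      dsimp
      ext
      apply h.hom_ext
      · have h₂ : (F.map (u ≫ s)).right ≫ (c.ι.app j'').right = (c.ι.app j).right := by
          rw [← Under.comp_right, c.w]
        simp only [Under.comp_right, Under.homMk_right, h.inl_desc_assoc, Category.assoc, h₂, hp]
      · simp
    · dsimp at f₁ f₂ hf ⊢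
      obtain ⟨j', u, v, huv⟩ := IsFinitelyPresentable.exists_eq_of_isColimit hc'
        (a' ≫ f₁.right) (a' ≫ f₂.right) (by
          have := congr(a' ≫ ($hf).right)
          simpa using this)
      obtain ⟨j'', s, hs⟩ := IsFilteredOrEmpty.cocone_maps u v
      refine ⟨j'', u ≫ s, ?_⟩
      ext
      apply h.hom_ext
      · have h₁ := congr($huv ≫ (F.map s).right)
        have h₂ : (F.map v).right ≫ (F.map s).right = (F.map (u ≫ s)).right := by
          rw [hs, F.map_comp]; rfl
        have h₃ : (F.map u).right ≫ (F.map s).right = (F.map (u ≫ s)).right := by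
          rw [F.map_comp]; rfl
        dsimp at h₁
        simp only [Category.assoc, h₂, h₃] at h₁
        simpa only [Under.comp_right] using h₁
      · simp⟩⟩

instance : (cosliceGenerator.{w} B).IsClosedUnderIsomorphisms where
  of_iso := by
    rintro l l' e ⟨K, K', k, a, a', hK, hK', h⟩
    exact ⟨K, K', k, a, a' ≫ e.hom.right, hK, hK',
      h.of_iso (Iso.refl _) (Iso.refl _) (Iso.refl _) ((Under.forget B).mapIso e)
        (by simp) (by simp) (by simp) (by simp)⟩

end

section

variable {𝓑 : Type u} [Category.{v} 𝓑] [IsLocallyFinitelyPresentable.{w} 𝓑]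

lemma isFinitelyPresentable_of_finCategory {J : Type} [SmallCategory J] [FinCategory J]
    {F : J ⥤ 𝓑} {c : Cocone F} (hc : IsColimit c)
    (hF : ∀ j, IsFinitelyPresentable.{w} (F.obj j)) : IsFinitelyPresentable.{w} c.pt :=
  isCardinalPresentable_of_isColimit _ hc ℵ₀ (by
    simp only [hasCardinalLT_aleph0_iff]; infer_instance)

lemma isFinitelyPresentable_of_isPushout {X Y Z T : 𝓑} {f : X ⟶ Y} {g : X ⟶ Z} {i : Y ⟶ T}
    {j : Z ⟶ T} (h : IsPushout f g i j) (hX : IsFinitelyPresentable.{w} X)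
    (hY : IsFinitelyPresentable.{w} Y) (hZ : IsFinitelyPresentable.{w} Z) :
    IsFinitelyPresentable.{w} T :=
  isFinitelyPresentable_of_finCategory h.isColimit (by rintro (_ | _ | _) <;> assumption)

/-- A morphism from a finitely presentable object to a pushout of a morphism `m` between finitely
presentable objects factors through a finitely presentable stage of the pushout. -/
lemma exists_isPushout_factorization {L L' B C X : 𝓑} {m : L ⟶ L'} {b : L ⟶ B} {b' : L' ⟶ C}
    {g : B ⟶ C} (h : IsPushout m b b' g) [IsFinitelyPresentable.{w} L]
    [IsFinitelyPresentable.{w} L'] [IsFinitelyPresentable.{w} X] (f : X ⟶ C) :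
    ∃ (M M' : 𝓑) (n : M ⟶ M') (d : M ⟶ B) (d' : M' ⟶ C) (f' : X ⟶ M'),
      IsFinitelyPresentable.{w} M ∧ IsFinitelyPresentable.{w} M' ∧ IsPushout n d d' g ∧
        f' ≫ d' = f := by
  have := hasFiniteColimits_of_hasColimitsOfSize.{w, w} 𝓑
  obtain ⟨J, _, _, ⟨p⟩⟩ :=
    (isCardinalFilteredGenerator_isCardinalPresentable 𝓑 ℵ₀).exists_colimitsOfShape B
  have := isFiltered_of_isCardinalFiltered J ℵ₀
  have hp (j : J) : IsFinitelyPresentable.{w} (p.diag.obj j) := p.prop_diag_obj j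
  obtain ⟨j, q, hq⟩ := IsFinitelyPresentable.exists_hom_of_isColimit p.isColimit b
  change q ≫ p.ι.app j = b at hq
  have sq := IsPushout.of_hasPushout m q
  have fpT : IsFinitelyPresentable.{w} (pushout m q) :=
    isFinitelyPresentable_of_isPushout sq ‹_› ‹_› (hp j)
  -- By pasting, `C` is also the pushout of `p.diag.obj j ⟶ pushout m q` along `p.diag.obj j ⟶ B`.
  let t : pushout m q ⟶ C := sq.desc b' (p.ι.app j ≫ g) (by rw [h.w, reassoc_of% hq])
  have hT : IsPushout (pushout.inr m q) (p.ι.app j) t g :=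
    IsPushout.of_top (h₁₁ := m) (v₁₁ := q) (v₁₂ := pushout.inl m q)
      (by simpa [hq, t] using h) (by simp [t]) sq
  let e : C ≅ pushout (p.ι.app j) (pushout.inr m q) := hT.flip.isoPushout
  -- Cobase change preserves colimits, so `C` is the filtered colimit, over the stages under `j`, of
  -- finitely presentable pushouts; `f` factors through one of them.
  obtain ⟨k, (f' : X ⟶ pushout (p.diag.map k.hom) (pushout.inr m q)), hf'⟩ :=
    IsFinitelyPresentable.exists_hom_of_isColimit
      (isColimitOfPreserves (Under.pushout (pushout.inr m q) ⋙ Under.forget _)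
        (p.isColimit.underPost j)) (f ≫ e.hom)
  replace hf' : f' ≫ pushout.desc (p.ι.app k.right ≫ pushout.inl (p.ι.app j) (pushout.inr m q))
      (pushout.inr _ _) (by simp [← pushout.condition]) = f ≫ e.hom := hf'
  have sqk := IsPushout.of_hasPushout (p.diag.map k.hom) (pushout.inr m q)
  let r : pushout (p.diag.map k.hom) (pushout.inr m q) ⟶ C :=
    sqk.desc (p.ι.app k.right ≫ g) t (by simp [hT.w])
  refine ⟨p.diag.obj k.right, _, pushout.inl (p.diag.map k.hom) (pushout.inr m q),
    p.ι.app k.right, r, f', hp _, ?_, ?_, ?_⟩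
  · exact isFinitelyPresentable_of_isPushout sqk (hp _) (hp _) fpT
  · exact IsPushout.of_top (h₁₁ := pushout.inr m q) (v₁₁ := p.diag.map k.hom)
      (v₁₂ := pushout.inr _ _) (by simpa [r] using hT) (by simp [r]) sqk.flip
  · rw [← cancel_mono e.hom, ← hf', Category.assoc]
    congr 1
    apply sqk.hom_ext
    · rw [sqk.inl_desc_assoc, Category.assoc, hT.flip.inl_isoPushout_hom]
      exact (pushout.inl_desc _ _ _).symm
    · rw [sqk.inr_desc_assoc, hT.flip.inr_isoPushout_hom]
      exact (pushout.inr_desc _ _ _).symm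

end

section

variable {𝓑 : Type u} [Category.{v} 𝓑] [IsLocallyFinitelyPresentable.{w} 𝓑] {B : 𝓑}

/-- Attaching every `K i ⟶ K' i` to `B` amounts to attaching `∐ K ⟶ ∐ K'` once. -/
lemma cosliceGenerator_of_isColimit_cofan {ι : Type*} [Finite ι] {X : ι → Under B}
    {c : Cofan X} (hc : IsColimit c) (hX : ∀ i, cosliceGenerator.{w} B (X i)) :
    cosliceGenerator.{w} B c.pt := by
  have := hasFiniteColimits_of_hasColimitsOfSize.{w, w} 𝓑
  have := hasFiniteCoproducts_of_hasFiniteColimits 𝓑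
  have hι : HasCardinalLT (Arrow (Discrete ι)) ℵ₀ := by
    simp only [hasCardinalLT_aleph0_iff]
    infer_instance
  choose K K' k a a' hK hK' h using hX
  have : HasLimitsOfShape (Discrete ι)ᵒᵖ (Type w) := inferInstance
  refine ⟨∐ K, ∐ K', Limits.Sigma.map k, Sigma.desc a,
    Sigma.desc fun i ↦ a' i ≫ (c.inj i).right, ?_, ?_, ⟨⟨?_⟩, ⟨?_⟩⟩⟩
  · have (i : Discrete ι) : IsCardinalPresentable ((Discrete.functor K).obj i) ℵ₀ := hK i.as
    exact isCardinalPresentable_of_isColimit _ (colimit.isColimit (Discrete.functor K)) ℵ₀ hι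
  · have (i : Discrete ι) : IsCardinalPresentable ((Discrete.functor K').obj i) ℵ₀ := hK' i.as
    exact isCardinalPresentable_of_isColimit _ (colimit.isColimit (Discrete.functor K')) ℵ₀ hι
  · ext i
    simp [reassoc_of% (h i).w]
  · let d (s : PushoutCocone (Limits.Sigma.map k) (Sigma.desc a)) :
        c.pt ⟶ Under.mk s.inr :=
      Cofan.IsColimit.desc hc fun i ↦ Under.homMk
        ((h i).desc (Sigma.ι K' i ≫ s.inl) s.inr
          (by simpa using Sigma.ι K i ≫= s.condition)) (by simp)
    have hd (s) (i : ι) : (c.inj i).right ≫ (d s).right =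
        (h i).desc (Sigma.ι K' i ≫ s.inl) s.inr
          (by simpa using Sigma.ι K i ≫= s.condition) := by
      rw [← Under.comp_right, Cofan.IsColimit.fac]
      rfl
    refine PushoutCocone.IsColimit.mk _ (fun s ↦ (d s).right) (fun s ↦ ?_)
      (fun s ↦ Under.w (d s)) (fun s m hm₁ hm₂ ↦ ?_)
    · ext i
      simp [hd]
    · let m' : c.pt ⟶ Under.mk s.inr := Under.homMk m hm₂
      suffices m' = d s from congr($(this).right)
      refine Cofan.IsColimit.hom_ext hc _ _ fun i ↦ ?_
      ext
      apply (h i).hom_ext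
      · have := Sigma.ι K' i ≫= hm₁
        simpa [hd, m'] using this
      · simp

/-- Maps under `B` out of `P` are determined on `K'`, so coequalizing `f` and `g` means coequalizing
two maps `K' ⟶ Q.right`. Both lift to a single finitely presentable `M'` presenting `Q`, and the
coequalizer can be taken there. -/
lemma cosliceGenerator_of_isColimit_cofork {P Q : Under B} {f g : P ⟶ Q} {c : Cofork f g}
    (hc : IsColimit c) (hP : cosliceGenerator.{w} B P) (hQ : cosliceGenerator.{w} B Q) :
    cosliceGenerator.{w} B c.pt := by
  have := hasFiniteColimits_of_hasColimitsOfSize.{w, w} 𝓑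
  obtain ⟨K, K', k, a, a', hK, hK', h⟩ := hP
  obtain ⟨L, L', m, b, b', hL, hL', h'⟩ := hQ
  have : IsFinitelyPresentable.{w} (K' ⨿ K') :=
    isFinitelyPresentable_of_finCategory (colimit.isColimit (pair K' K'))
      (by rintro ⟨_ | _⟩ <;> assumption)
  obtain ⟨M, M', n, d, d', φ, hM, hM', sq, hφ⟩ :=
    exists_isPushout_factorization h' (coprod.desc (a' ≫ f.right) (a' ≫ g.right))
  have hφ₁ : (coprod.inl ≫ φ) ≫ d' = a' ≫ f.right := by
    rw [Category.assoc, hφ, coprod.inl_desc]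
  have hφ₂ : (coprod.inr ≫ φ) ≫ d' = a' ≫ g.right := by
    rw [Category.assoc, hφ, coprod.inr_desc]
  generalize coprod.inl ≫ φ = φ₁ at hφ₁
  generalize coprod.inr ≫ φ = φ₂ at hφ₂
  have w₁ : φ₁ ≫ d' ≫ c.π.right = φ₂ ≫ d' ≫ c.π.right := by
    rw [reassoc_of% hφ₁, reassoc_of% hφ₂, ← Under.comp_right, ← Under.comp_right, c.condition]
  refine ⟨M, coequalizer φ₁ φ₂, n ≫ coequalizer.π φ₁ φ₂, d,
    coequalizer.desc (d' ≫ c.π.right) w₁, hM, ?_, ⟨⟨?_⟩, ⟨?_⟩⟩⟩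
  · exact isFinitelyPresentable_of_finCategory (colimit.isColimit (parallelPair φ₁ φ₂))
      (by rintro (_ | _) <;> assumption)
  · simp [reassoc_of% sq.w]
  · let e (s : PushoutCocone (n ≫ coequalizer.π φ₁ φ₂) d) : Q ⟶ Under.mk s.inr :=
      Under.homMk (sq.desc (coequalizer.π φ₁ φ₂ ≫ s.inl) s.inr
        (by simpa using s.condition)) (by simp)
    have he (s) : f ≫ e s = g ≫ e s := by
      ext
      apply h.hom_ext
      · simp only [Under.comp_right, ← reassoc_of% hφ₁, ← reassoc_of% hφ₂]
        simp only [e, Under.homMk_right, IsPushout.inl_desc]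
        rw [coequalizer.condition_assoc]
      · simp
    refine PushoutCocone.IsColimit.mk _ (fun s ↦ (Cofork.IsColimit.desc hc (e s) (he s)).right)
      (fun s ↦ ?_) (fun s ↦ Under.w (Cofork.IsColimit.desc hc (e s) (he s)))
      (fun s m hm₁ hm₂ ↦ ?_)
    · ext
      simp [← Under.comp_right, e]
    · let m' : c.pt ⟶ Under.mk s.inr := Under.homMk m hm₂
      suffices m' = Cofork.IsColimit.desc hc (e s) (he s) from congr($(this).right)
      apply Cofork.IsColimit.hom_ext hc
      ext
      apply sq.hom_ext
      · have := coequalizer.π φ₁ φ₂ ≫= hm₁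
        simpa [e, m'] using this
      · simp

lemma isClosedUnderColimitsOfShape_cosliceGenerator {J : Type w} [SmallCategory J]
    (hJ : HasCardinalLT (Arrow J) ℵ₀) :
    (cosliceGenerator.{w} B).IsClosedUnderColimitsOfShape J where
  colimitsOfShape_le := by
    rintro X ⟨p⟩
    have : Finite (Arrow J) := by rwa [hasCardinalLT_aleph0_iff] at hJ
    have : Finite J := Finite.of_injective (fun j ↦ Arrow.mk (𝟙 j)) fun _ _ h ↦
      congr_arg Comma.left h
    have : Finite (Σ p : J × J, p.1 ⟶ p.2) :=
      Finite.of_injective (fun f ↦ Arrow.mk f.2) (by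
        rintro ⟨⟨i, j⟩, f⟩ ⟨⟨i', j'⟩, f'⟩ h
        obtain rfl : i = i' := congr_arg Comma.left h
        obtain rfl : j = j' := congr_arg Comma.right h
        obtain rfl : f = f' := Arrow.mk_injective _ _ h
        rfl)
    have := hasFiniteColimits_of_hasColimitsOfSize.{w, w} (Under B)
    let F := p.diag
    let c := colimitCoconeOfCoequalizerAndCoproduct F
    have hc : cosliceGenerator.{w} B c.cocone.pt :=
      cosliceGenerator_of_isColimit_cofork (colimit.isColimit _)
        (cosliceGenerator_of_isColimit_cofan (coproductIsCoproduct _) fun f ↦ p.prop_diag_obj _)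
        (cosliceGenerator_of_isColimit_cofan (coproductIsCoproduct _) fun j ↦ p.prop_diag_obj j)
    exact ObjectProperty.prop_of_iso _ (c.isColimit.coconePointUniqueUpToIso p.isColimit) hc

-- The functor `X ↦ (B ⟶ B ⨿ X)` is left adjoint to the forgetful functor, which is faithful,
-- preserves monomorphisms and reflects isomorphisms; so it carries a strong generator to one.
variable (B) in
lemma exists_isStrongGenerator_under :
    ∃ (P : ObjectProperty (Under B)) (_ : ObjectProperty.Small.{w} P), P.IsStrongGenerator ∧
      P ≤ cosliceGenerator.{w} B := by
  have := hasFiniteColimits_of_hasColimitsOfSize.{w, w} 𝓑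
  obtain ⟨G, _, hG⟩ := HasCardinalFilteredGenerator.exists_small_generator 𝓑 ℵ₀
  have hG' := hG.isStrongGenerator
  let F (X : Subtype G) : Under B := Under.mk (coprod.inl : B ⟶ B ⨿ X.1)
  let φ {X : 𝓑} (hX : G X) {Y : Under B} (f : X ⟶ Y.right) : F ⟨X, hX⟩ ⟶ Y :=
    Under.homMk (coprod.desc Y.hom f) (coprod.inl_desc _ _)
  have hφ {X : 𝓑} (hX : G X) {Y : Under B} (f : X ⟶ Y.right) : coprod.inr ≫ (φ hX f).right = f :=
    coprod.inr_desc _ _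
  refine ⟨ObjectProperty.ofObj F, inferInstance, ?_, ?_⟩
  · rw [ObjectProperty.isStrongGenerator_iff]
    refine ⟨fun X Y f g h ↦ ?_, fun X Y i _ h ↦ ?_⟩
    · ext
      refine hG'.isSeparating _ _ fun Z hZ z ↦ ?_
      have := coprod.inr ≫= congr($(h (F ⟨Z, hZ⟩) ⟨_⟩ (φ hZ z)).right)
      rwa [Under.comp_right, Under.comp_right, ← Category.assoc, ← Category.assoc, hφ] at this
    · have : Mono i.right := inferInstanceAs (Mono ((Under.forget B).map i))
      have : IsIso ((Under.forget B).map i) := hG'.isIso_of_mono i.right fun Z hZ z ↦ by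
        obtain ⟨t, ht⟩ := h (F ⟨Z, hZ⟩) ⟨_⟩ (φ hZ z)
        exact ⟨coprod.inr ≫ t.right, by simpa [hφ] using coprod.inr ≫= congr($(ht).right)⟩
      exact isIso_of_reflects_iso i (Under.forget B)
  · rintro _ ⟨X, hX⟩
    refine ⟨⊥_ 𝓑, X, initial.to X, initial.to B, coprod.inr, ?_, ?_, ?_⟩
    · exact isFinitelyPresentable_of_finCategory (colimit.isColimit (Functor.empty.{0} 𝓑))
        (by rintro ⟨⟨⟩⟩)
    · exact hG.le_isCardinalPresentable _ hX
    · exact (IsPushout.of_hasBinaryCoproduct' B X).flip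

variable (B) in
lemma isLocallyFinitelyPresentable_under : IsLocallyFinitelyPresentable.{w} (Under B) := by
  obtain ⟨P, _, hP, hP'⟩ := exists_isStrongGenerator_under.{w} B
  exact (IsCardinalLocallyPresentable.iff_exists_isStrongGenerator _ _).2
    ⟨P, inferInstance, hP,
      fun l hl ↦ isFinitelyPresentable_of_cosliceGenerator l (hP' l hl)⟩

variable (B) in
lemma isFinitelyPresentable_under_eq_cosliceGenerator :
    ObjectProperty.isFinitelyPresentable.{w} (Under B) = cosliceGenerator.{w} B := by
  refine le_antisymm ?_ isFinitelyPresentable_of_cosliceGenerator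
  obtain ⟨P, _, hP, hP'⟩ := exists_isStrongGenerator_under.{w} B
  rw [ObjectProperty.isFinitelyPresentable_eq_isCardinalPresentable,
    IsStrongGenerator.colimitsCardinalClosure_eq_isCardinalPresentable hP
      fun l hl ↦ isFinitelyPresentable_of_cosliceGenerator l (hP' l hl)]
  exact P.colimitsCardinalClosure_le ℵ₀
    (fun _ _ hJ ↦ isClosedUnderColimitsOfShape_cosliceGenerator hJ) hP'

end

theorem mainTheorem1 {𝓑 : Type u} [Category.{v} 𝓑] [IsLocallyFinitelyPresentable.{w} 𝓑] (B : 𝓑) :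
    IsLocallyFinitelyPresentable.{w} (Under B) ∧
    (∀ l : Under B, IsFinitelyPresentable.{w} l ↔ cosliceGenerator.{w} B l) ∧
    ∃ e : (ObjectProperty.isFinitelyPresentable.{w} (Under B)).FullSubcategory ≌
        (cosliceGenerator.{w} B).FullSubcategory,
      Nonempty (e.functor ⋙ (cosliceGenerator.{w} B).ι ≅
        (ObjectProperty.isFinitelyPresentable.{w} (Under B)).ι) := by
  have h := isFinitelyPresentable_under_eq_cosliceGenerator.{w} B
  refine ⟨isLocallyFinitelyPresentable_under B, fun l ↦ iff_of_eq (congr_fun h l), ?_⟩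
  rw [h]
  exact ⟨CategoryTheory.Equivalence.refl, ⟨Functor.leftUnitor _⟩⟩
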